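/- Consider batteries made of $n$ two-level cells, each with Hamiltonian $\hat h=|1\rangle\langle 1|$, and let $\hat H^{(n)}=\hat h_1+\dots+\hat h_n$ be the total Hamiltonian. For a state $\hat\rho$ and a Hamiltonian $\hat H$ let $$\mathcal E(\hat\rho;\hat H)=\max_{\hat U\ \mathrm{unitary}}\big\{\mathrm{Tr}[\hat\rho\hat H]-\mathrm{Tr}[\hat U\hat\rho\,\hat U^\dagger\hat H]\big\}$$ be the ergotropy. For a qubit channel $\Lambda$ let $\mathcal E^{(n)}_{\rm sep}(\Lambda;E)$ be the maximum of $\mathcal E(\Lambda^{\otimes n}(\hat\rho);\hat H^{(n)})$ over all (fully) separable $n$-cell states $\hat\rho$ with $\mathrm{Tr}[\hat\rho\hat H^{(n)}]\le E$, and let $$C_{\rm sep}(\Lambda;\mathfrak e)=\lim_{n\to\infty}\frac{\mathcal E^{(n)}_{\rm sep}(\Lambda;n\mathfrak e)}{n}$$ be the separable-input ergotropic capacitance. Let $\mathcal E^{(1)}(\Lambda;\mathfrak e)$ be the maximum of $\mathcal E(\Lambda(\hat\rho);\hat h)$ over all one-cell states $\hat\rho$ with $\mathrm{Tr}[\hat\rho\hat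 h]\le\mathfrak e$, and let $$\chi(\Lambda;\mathfrak e)=\sup\sum_j p_j\,\mathcal E^{(1)}(\Lambda;\mathfrak e_j),$$ the supremum being over all finite probability distributions $\{p_j,\mathfrak e_j\}$ of energies $\mathfrak e_j\in[0,1]$ with $\sum_j p_j\mathfrak e_j\le\mathfrak e$. For $\gamma\in[0,1]$ and $\eta\in[0,1/2]$ the generalized amplitude damping channel acts on qubit density matrices as $$\Phi_{\gamma,\eta}(\hat\rho)=\begin{pmatrix}1-\gamma\eta-(1-\gamma)\rho_{11}&\sqrt{1-\gamma}\,\rho_{01}\\ \sqrt{1-\gamma}\,\rho_{10}&\gamma\eta+(1-\gamma)\rho_{11}\end{pmatrix},$$ and the amplitude damping channel as $$\Phi_{\gamma}(\hat\rho)=\begin{pmatrix}\rho_{00}+\gamma\rho_{11}&\sqrt{1-\gamma}\,\rho_{01}\\ \sqrt{1-\gamma}\,\rho_{10}&(1-\gamma)\rho_{11}\end{pmatrix}.$$ Then for all $\gamma\in[0,1]$, $\eta\in[0,1/2]$ and $\mathfrak e\in[0,1]$ the limits that define $C_{\rm sep}(\Phi_{\gamma,\eta};\mathfrak e)$ and $C_{\rm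 sep}(\Phi_\gamma;\mathfrak e)$ exist, and $$C_{\rm sep}(\Phi_{\gamma,\eta};\mathfrak e)=\chi(\Phi_{\gamma,\eta};\mathfrak e),\qquad C_{\rm sep}(\Phi_{\gamma};\mathfrak e)=\chi(\Phi_{\gamma};\mathfrak e).$$ -/

import Mathlib

open Filter Topology
open scoped ComplexOrder

namespace QBattery

noncomputable section

/-- Density matrices: positive semidefinite, of trace one. -/
def IsDensity {m : Type*} [Fintype m] (ρ : Matrix m m ℂ) : Prop :=
  ρ.PosSemidef ∧ ρ.trace = 1

/-- Mean energy `Tr[ρ H]`. -/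
def energy {m : Type*} [Fintype m] (ρ H : Matrix m m ℂ) : ℝ :=
  (ρ * H).trace.re

/-- Ergotropy: the maximum over all unitaries `U` of `Tr[ρ H] - Tr[U ρ U† H]`. -/
def ergotropy {m : Type*} [Fintype m] [DecidableEq m] (ρ H : Matrix m m ℂ) : ℝ :=
  sSup {w : ℝ | ∃ U ∈ Matrix.unitaryGroup m ℂ,
    w = energy ρ H - energy (U * ρ * U.conjTranspose) H}

/-- The tensor product `σ₁ ⊗ ⋯ ⊗ σₙ`, in the product basis of the `n` cells, which is indexed
by the functions `Fin n → m`. -/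
def tensor {m : Type*} {n : ℕ} (σ : Fin n → Matrix m m ℂ) :
    Matrix (Fin n → m) (Fin n → m) ℂ :=
  Matrix.of fun i j => ∏ t, σ t (i t) (j t)

/-- The Hamiltonian `h₁ + ⋯ + hₙ` of `n` non-interacting cells with local Hamiltonian `h`;
the `t`-th term acts as `h` on cell `t` and as the identity on all other cells. -/
def totalHamiltonian {m : Type*} [DecidableEq m] (h : Matrix m m ℂ) (n : ℕ) :
    Matrix (Fin n → m) (Fin n → m) ℂ :=
  ∑ t : Fin n, tensor (Function.update (fun _ => (1 : Matrix m m ℂ)) t h)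

/-- The map `Λ ⊗ ⋯ ⊗ Λ` (`n` factors): the linear map that sends each product matrix unit
`E_{k₁ l₁} ⊗ ⋯ ⊗ E_{kₙ lₙ}` to `Λ(E_{k₁ l₁}) ⊗ ⋯ ⊗ Λ(E_{kₙ lₙ})`. -/
def tensorPow {m : Type*} [Fintype m] [DecidableEq m]
    (Λ : Matrix m m ℂ →ₗ[ℂ] Matrix m m ℂ) (n : ℕ)
    (ρ : Matrix (Fin n → m) (Fin n → m) ℂ) : Matrix (Fin n → m) (Fin n → m) ℂ :=
  ∑ k, ∑ l, ρ k l • tensor fun t => Λ (Matrix.single (k t) (l t) (1 : ℂ))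

/-- On a product matrix the map `Λ ⊗ ⋯ ⊗ Λ` acts factor by factor. -/
theorem tensorPow_tensor {m : Type*} [Fintype m] [DecidableEq m]
    (Λ : Matrix m m ℂ →ₗ[ℂ] Matrix m m ℂ) (n : ℕ) (σ : Fin n → Matrix m m ℂ) :
    tensorPow Λ n (tensor σ) = tensor fun t => Λ (σ t) := by
  have key : ∀ (A : Matrix m m ℂ) (a b : m),
      Λ A a b = ∑ x : m × m, A x.1 x.2 * Λ (Matrix.single x.1 x.2 (1 : ℂ)) a b := by
    intro A a b
    conv_lhs => rw [Matrix.matrix_eq_sum_single A]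
    rw [Fintype.sum_prod_type]
    simp only [map_sum, Matrix.sum_apply]
    refine Finset.sum_congr rfl fun x _ => Finset.sum_congr rfl fun y _ => ?_
    have : Matrix.single x y (A x y) = A x y • Matrix.single x y (1 : ℂ) := by
      simp [Matrix.smul_single]
    rw [this, map_smul]; rfl
  ext i j
  simp only [tensorPow, tensor, Matrix.sum_apply, Matrix.smul_apply, Matrix.of_apply,
    smul_eq_mul, ← Finset.prod_mul_distrib]
  rw [Finset.prod_congr rfl fun t _ => key (σ t) (i t) (j t), Finset.prod_univ_sum,
    Fintype.piFinset_univ, ← Fintype.sum_prod_type'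
      (fun (k l : Fin n → m) => ∏ t, σ t (k t) (l t) *
        Λ (Matrix.single (k t) (l t) (1 : ℂ)) (i t) (j t))]
  exact (Equiv.sum_comp (Equiv.arrowProdEquivProdArrow (Fin n) (fun _ => m) (fun _ => m))
    (fun x : (Fin n → m) × (Fin n → m) => ∏ t, σ t (x.1 t) (x.2 t) *
        Λ (Matrix.single (x.1 t) (x.2 t) (1 : ℂ)) (i t) (j t))).symm

/-- Separable states of `n` cells: convex combinations of products of density matrices. -/
def IsSeparable {m : Type*} [Fintype m] {n : ℕ}
    (ρ : Matrix (Fin n → m) (Fin n → m) ℂ) : Prop :=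
  ρ ∈ convexHull ℝ {τ | ∃ σ : Fin n → Matrix m m ℂ, (∀ t, IsDensity (σ t)) ∧ τ = tensor σ}

/-- Maximum ergotropy at the output of `n` uses of `Λ`, over all separable input states of mean
energy at most `E`. -/
def maxErgotropySep {m : Type*} [Fintype m] [DecidableEq m]
    (Λ : Matrix m m ℂ →ₗ[ℂ] Matrix m m ℂ) (h : Matrix m m ℂ) (n : ℕ) (E : ℝ) : ℝ :=
  sSup {w : ℝ | ∃ ρ : Matrix (Fin n → m) (Fin n → m) ℂ, IsSeparable ρ ∧
    energy ρ (totalHamiltonian h n) ≤ E ∧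
    w = ergotropy (tensorPow Λ n ρ) (totalHamiltonian h n)}

/-- The separable-input ergotropic capacitance: the limit for `n → ∞` of the maximum output
ergotropy per cell, at input energy at most `n 𝔢`. -/
def sepCapacitance {m : Type*} [Fintype m] [DecidableEq m]
    (Λ : Matrix m m ℂ →ₗ[ℂ] Matrix m m ℂ) (h : Matrix m m ℂ) (e : ℝ) : ℝ :=
  limUnder atTop fun n : ℕ => maxErgotropySep Λ h n (n * e) / n

/-- Maximum ergotropy at the output of a single use of `Λ`, over all states of one cell of mean
energy at most `E`. -/
def maxErgotropyOne {m : Type*} [Fintype m] [DecidableEq m]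
    (Λ : Matrix m m ℂ →ₗ[ℂ] Matrix m m ℂ) (h : Matrix m m ℂ) (E : ℝ) : ℝ :=
  sSup {w : ℝ | ∃ ρ : Matrix m m ℂ, IsDensity ρ ∧ energy ρ h ≤ E ∧ w = ergotropy (Λ ρ) h}

/-- `χ(Λ; 𝔢)`: the supremum of `∑ pⱼ 𝓔⁽¹⁾(Λ; 𝔢ⱼ)` over the finite probability distributions
`{pⱼ, 𝔢ⱼ}` of cell energies `𝔢ⱼ ∈ [0, 1]` with `∑ pⱼ 𝔢ⱼ ≤ 𝔢`. -/
def chi {m : Type*} [Fintype m] [DecidableEq m]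
    (Λ : Matrix m m ℂ →ₗ[ℂ] Matrix m m ℂ) (h : Matrix m m ℂ) (e : ℝ) : ℝ :=
  sSup {x : ℝ | ∃ (k : ℕ) (p ε : Fin k → ℝ), (∀ j, 0 ≤ p j) ∧ ∑ j, p j = 1 ∧
    (∀ j, ε j ∈ Set.Icc (0 : ℝ) 1) ∧ ∑ j, p j * ε j ≤ e ∧
    x = ∑ j, p j * maxErgotropyOne Λ h (ε j)}

/-- The qubit Hamiltonian `|1⟩⟨1|`. -/
def qubitHamiltonian : Matrix (Fin 2) (Fin 2) ℂ :=
  !![0, 0; 0, 1]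

/-- The amplitude damping channel `Φ_γ`. -/
def adc (γ : ℝ) : Matrix (Fin 2) (Fin 2) ℂ →ₗ[ℂ] Matrix (Fin 2) (Fin 2) ℂ where
  toFun ρ := !![ρ 0 0 + (γ : ℂ) * ρ 1 1, (√(1 - γ) : ℂ) * ρ 0 1;
                (√(1 - γ) : ℂ) * ρ 1 0, (1 - (γ : ℂ)) * ρ 1 1]
  map_add' ρ σ := by
    ext i j
    fin_cases i <;> fin_cases j <;> simp <;> ring
  map_smul' c ρ := by
    ext i j
    fin_cases i <;> fin_cases j <;> simp <;> ring

/-- The generalized amplitude damping channel `Φ_{γ,η}`, as a linear map: the constants of the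
usual formula for density matrices are multiplied by `Tr ρ` (see `gadc_of_trace_eq_one`). -/
def gadc (γ η : ℝ) : Matrix (Fin 2) (Fin 2) ℂ →ₗ[ℂ] Matrix (Fin 2) (Fin 2) ℂ where
  toFun ρ := !![(1 - (γ : ℂ) * η) * ρ.trace - (1 - (γ : ℂ)) * ρ 1 1, (√(1 - γ) : ℂ) * ρ 0 1;
                (√(1 - γ) : ℂ) * ρ 1 0, (γ : ℂ) * η * ρ.trace + (1 - (γ : ℂ)) * ρ 1 1]
  map_add' ρ σ := by
    ext i j
    fin_cases i <;> fin_cases j <;> simp <;> ring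
  map_smul' c ρ := by
    ext i j
    fin_cases i <;> fin_cases j <;> simp <;> ring

theorem gadc_of_trace_eq_one (γ η : ℝ) (ρ : Matrix (Fin 2) (Fin 2) ℂ) (hρ : ρ.trace = 1) :
    gadc γ η ρ =
      !![1 - (γ : ℂ) * η - (1 - (γ : ℂ)) * ρ 1 1, (√(1 - γ) : ℂ) * ρ 0 1;
         (√(1 - γ) : ℂ) * ρ 1 0, (γ : ℂ) * η + (1 - (γ : ℂ)) * ρ 1 1] := by
  simp [gadc, hρ]

theorem gadc_zero (γ : ℝ) : gadc γ 0 = adc γ := by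
  ext ρ i j
  fin_cases i <;> fin_cases j <;> simp [gadc, adc, Matrix.trace_fin_two]
  ring

end

end QBattery

/-! A qubit state with determinant x²/4 has spectrum (1 - `minEig x`, `minEig x`), so its least
energy under unitaries is `minEig x`. For input energy ε, the output determinant of `gadc γ η` is
least on pure inputs, where x = c(ε) = `gadcConcurrence γ η ε`. One use at energy ε thus yields at
best f(ε) = `gadcErgotropy γ η ε`.

For a product input, a global unitary preserves the total entropy, and Gibbs' inequality bounds the
final energy below by that of a thermal product state of no larger entropy
(`mul_minEig_le_energy_conj_tensor`). The bound becomes additive because c is convex and the qubit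
entropy is convex and increasing in x (`convexOn_binEntropy_minEig`). By Jensen, the output entropy
is at least n times the qubit entropy at c of the mean input energy, so the gain is at most n f(mean
energy).

Concavity of f extends this to separable inputs (`IsSeparable.gadc_bound`) and makes energy sharing
useless in `chi` (`chi_gadc`). Identical pure inputs and local unitaries attain the bound, so the
rate is the same for every n > 0. Amplitude damping is the case η = 0. -/

namespace QBattery

/-! ### Tensor products and product distributions -/

section TensorAlgebra

theorem tensor_conjTranspose {m : Type*} {n : ℕ} (σ : Fin n → Matrix m m ℂ) :
    (tensor σ).conjTranspose = tensor fun t => (σ t).conjTranspose := by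
  ext i j
  simp [tensor, Matrix.conjTranspose_apply, star_prod]

theorem tensor_diagonal {m : Type*} [DecidableEq m] {n : ℕ} (d : Fin n → m → ℂ) :
    tensor (fun t => Matrix.diagonal (d t)) = Matrix.diagonal fun i => ∏ t, d t (i t) := by
  ext i j
  by_cases h : i = j
  · subst h; simp [tensor]
  · obtain ⟨t, ht⟩ := Function.ne_iff.mp h
    rw [Matrix.diagonal_apply_ne _ h]
    exact Finset.prod_eq_zero (Finset.mem_univ t) (Matrix.diagonal_apply_ne _ ht)

variable {m : Type*} [Fintype m] {n : ℕ}

theorem tensor_mul (σ τ : Fin n → Matrix m m ℂ) :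
    tensor σ * tensor τ = tensor fun t => σ t * τ t := by
  classical
  ext i j
  simp only [tensor, Matrix.mul_apply, Matrix.of_apply, ← Finset.prod_mul_distrib]
  rw [Finset.prod_univ_sum, Fintype.piFinset_univ]

theorem tensor_one {m : Type*} {n : ℕ} [DecidableEq m] : tensor (fun _ : Fin n => (1 : Matrix m m ℂ)) = 1 := by
  simpa using tensor_diagonal (fun (_ : Fin n) (_ : m) => (1 : ℂ))

theorem tensor_mem_unitaryGroup [DecidableEq m] {U : Fin n → Matrix m m ℂ}
    (hU : ∀ t, U t ∈ Matrix.unitaryGroup m ℂ) :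
    tensor U ∈ Matrix.unitaryGroup (Fin n → m) ℂ := by
  rw [Matrix.mem_unitaryGroup_iff, Matrix.star_eq_conjTranspose, tensor_conjTranspose, tensor_mul,
    ← tensor_one]
  congr 1
  ext1 t
  exact Matrix.mem_unitaryGroup_iff.mp (hU t)

theorem totalHamiltonian_diagonal {m : Type*} {n : ℕ} [DecidableEq m] (v : m → ℂ) :
    totalHamiltonian (Matrix.diagonal v) n = Matrix.diagonal fun i => ∑ t, v (i t) := by
  have key : ∀ t : Fin n, tensor (Function.update (fun _ => (1 : Matrix m m ℂ)) t
      (Matrix.diagonal v)) = Matrix.diagonal fun i => v (i t) := by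
    intro t
    have h1 : Function.update (fun _ => (1 : Matrix m m ℂ)) t (Matrix.diagonal v) =
        fun s => Matrix.diagonal (Function.update (fun _ _ => (1 : ℂ)) t v s) := by
      ext1 s
      by_cases hs : s = t
      · subst hs; simp
      · simp [Function.update_of_ne hs]
    rw [h1, tensor_diagonal]
    congr 1
    ext i
    rw [Finset.prod_eq_single t]
    · simp
    · intro s _ hs; simp [Function.update_of_ne hs]
    · simp
  simp only [totalHamiltonian, key]
  ext i j
  by_cases h : i = j
  · subst h; simp [Matrix.sum_apply]
  · simp [Matrix.sum_apply, h]

/-- Expectation of an additive function under a product distribution. -/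
theorem sum_prod_mul_sum {R : Type*} [CommSemiring R] (p g : Fin n → m → R)
    (hp : ∀ t, ∑ a, p t a = 1) :
    ∑ i : Fin n → m, (∏ t, p t (i t)) * ∑ s, g s (i s) = ∑ s, ∑ a, p s a * g s a := by
  classical
  simp only [Finset.mul_sum]
  rw [Finset.sum_comm]
  refine Finset.sum_congr rfl fun s _ => ?_
  -- The factor at site s is absorbed into the product, so that the sum over configurations
  -- factorises.
  have h1 : ∀ i : Fin n → m, (∏ t, p t (i t)) * g s (i s) =
      ∏ t, p t (i t) * Function.update (fun _ _ => (1 : R)) s (g s) t (i t) := by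
    intro i
    rw [Finset.prod_mul_distrib]
    congr 1
    rw [Finset.prod_eq_single s]
    · simp
    · intro t _ ht; simp [Function.update_of_ne ht]
    · simp
  rw [Finset.sum_congr rfl fun i _ => h1 i, ← Fintype.piFinset_univ,
    ← Finset.prod_univ_sum (fun _ => Finset.univ)
      (fun t a => p t a * Function.update (fun _ _ => (1 : R)) s (g s) t a),
    Finset.prod_eq_single s]
  · simp
  · intro t _ ht; simp [Function.update_of_ne ht, hp]
  · simp

theorem sum_prod_eq_one {R : Type*} [CommSemiring R] (p : Fin n → m → R)
    (hp : ∀ t, ∑ a, p t a = 1) : ∑ i : Fin n → m, ∏ t, p t (i t) = 1 := by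
  classical
  rw [← Fintype.piFinset_univ, ← Finset.prod_univ_sum (fun _ => Finset.univ) p]
  simp [hp]

/-- The entropy of a product distribution is the sum of the entropies of the factors. -/
theorem sum_negMulLog_prod (p : Fin n → m → ℝ) (hp : ∀ t, ∑ a, p t a = 1) :
    ∑ i : Fin n → m, Real.negMulLog (∏ t, p t (i t)) = ∑ t, ∑ a, Real.negMulLog (p t a) := by
  have h1 : ∀ i : Fin n → m, Real.negMulLog (∏ t, p t (i t)) =
      (∏ t, p t (i t)) * ∑ t, -Real.log (p t (i t)) := by
    intro i
    by_cases h : ∏ t, p t (i t) = 0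
    · simp [h]
    · rw [Real.negMulLog, Real.log_prod (fun t _ => (Finset.prod_ne_zero_iff.mp h) t
        (Finset.mem_univ t)), Finset.sum_neg_distrib]
      ring
  rw [Finset.sum_congr rfl fun i _ => h1 i,
    sum_prod_mul_sum p (fun t a => -Real.log (p t a)) hp]
  simp [Real.negMulLog]

theorem energy_diagonal [DecidableEq m] (ρ : Matrix m m ℂ) (v : m → ℝ) :
    energy ρ (Matrix.diagonal fun i => (v i : ℂ)) = ∑ i, (ρ i i).re * v i := by
  simp [energy, Matrix.trace]

theorem energy_totalHamiltonian [DecidableEq m] (ρ : Matrix (Fin n → m) (Fin n → m) ℂ)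
    (v : m → ℝ) :
    energy ρ (totalHamiltonian (Matrix.diagonal fun a => (v a : ℂ)) n) =
      ∑ i, (ρ i i).re * ∑ t, v (i t) := by
  rw [totalHamiltonian_diagonal, ← energy_diagonal]
  push_cast
  rfl

theorem energy_tensor [DecidableEq m] (σ : Fin n → Matrix m m ℂ) (hσ : ∀ t, (σ t).trace = 1)
    (v : m → ℝ) :
    energy (tensor σ) (totalHamiltonian (Matrix.diagonal fun a => (v a : ℂ)) n) =
      ∑ t, energy (σ t) (Matrix.diagonal fun a => (v a : ℂ)) := by
  have := sum_prod_mul_sum (fun t a => σ t a a) (fun _ a => (v a : ℂ)) hσ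
  rw [totalHamiltonian_diagonal]
  simp only [energy, Matrix.trace, Matrix.diag_apply, Matrix.mul_diagonal, ← Complex.re_sum]
  congr 1

theorem energy_add (ρ σ H : Matrix m m ℂ) : energy (ρ + σ) H = energy ρ H + energy σ H := by
  simp [energy, add_mul]

theorem energy_smul (a : ℝ) (ρ H : Matrix m m ℂ) : energy (a • ρ) H = a * energy ρ H := by
  simp [energy]

variable [DecidableEq m]

theorem tensorPow_add (Λ : Matrix m m ℂ →ₗ[ℂ] Matrix m m ℂ)
    (ρ σ : Matrix (Fin n → m) (Fin n → m) ℂ) :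
    tensorPow Λ n (ρ + σ) = tensorPow Λ n ρ + tensorPow Λ n σ := by
  simp [tensorPow, add_smul, Finset.sum_add_distrib]

theorem tensorPow_smul (Λ : Matrix m m ℂ →ₗ[ℂ] Matrix m m ℂ) (a : ℝ)
    (ρ : Matrix (Fin n → m) (Fin n → m) ℂ) :
    tensorPow Λ n (a • ρ) = a • tensorPow Λ n ρ := by
  simp only [tensorPow, Finset.smul_sum, Matrix.smul_apply, smul_assoc]

end TensorAlgebra

/-! ### Gibbs' inequality for unitary orbits -/

section Gibbs

variable {ι : Type*} [Fintype ι] [DecidableEq ι]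

theorem sum_normSq_row {W : Matrix ι ι ℂ} (hW : W ∈ Matrix.unitaryGroup ι ℂ) (i : ι) :
    ∑ j, Complex.normSq (W i j) = 1 := by
  have h := congrFun (congrFun (Matrix.mem_unitaryGroup_iff.mp hW) i) i
  simp only [Matrix.mul_apply, Matrix.star_apply, Matrix.one_apply_eq, RCLike.star_def,
    Complex.mul_conj] at h
  exact_mod_cast h

theorem sum_normSq_col {W : Matrix ι ι ℂ} (hW : W ∈ Matrix.unitaryGroup ι ℂ) (j : ι) :
    ∑ i, Complex.normSq (W i j) = 1 := by
  have h := congrFun (congrFun (Matrix.mem_unitaryGroup_iff'.mp hW) j) j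
  simp only [Matrix.mul_apply, Matrix.star_apply, Matrix.one_apply_eq, RCLike.star_def,
    mul_comm, Complex.mul_conj] at h
  exact_mod_cast h

theorem conj_diagonal_diag_re (W : Matrix ι ι ℂ) (d : ι → ℝ) (i : ι) :
    ((W * Matrix.diagonal (fun j => (d j : ℂ)) * W.conjTranspose) i i).re =
      ∑ j, Complex.normSq (W i j) * d j := by
  rw [Matrix.mul_apply, Complex.re_sum]
  refine Finset.sum_congr rfl fun j _ => ?_
  rw [Matrix.mul_diagonal, Matrix.conjTranspose_apply, RCLike.star_def, mul_right_comm,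
    Complex.mul_conj, ← Complex.ofReal_mul, Complex.ofReal_re]

/-- This is log t ≤ t - 1 at t = b/a. The correction b - a cancels once summed against doubly
stochastic weights. -/
theorem negMulLog_le {a b : ℝ} (ha : 0 ≤ a) (hb : 0 < b) :
    Real.negMulLog a ≤ a * (-Real.log b) + (b - a) := by
  rcases ha.eq_or_lt with rfl | ha
  · simpa using hb.le
  · have h := Real.log_le_sub_one_of_pos (div_pos hb ha)
    rw [Real.log_div hb.ne' ha.ne'] at h
    have h2 := mul_le_mul_of_nonneg_left h ha.le
    have h3 : a * (b / a - 1) = b - a := by field_simp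
    rw [h3] at h2
    rw [Real.negMulLog]
    linarith

/-- Gibbs' inequality for the diagonal of a Hermitian matrix with spectrum `d`. -/
theorem gibbs_inequality {W : Matrix ι ι ℂ} (hW : W ∈ Matrix.unitaryGroup ι ℂ) {d q : ι → ℝ}
    (hd : ∀ j, 0 ≤ d j) (hd1 : ∑ j, d j = 1) (hq : ∀ i, 0 < q i) (hq1 : ∑ i, q i = 1) :
    ∑ j, Real.negMulLog (d j) ≤
      ∑ i, ((W * Matrix.diagonal (fun j => (d j : ℂ)) * W.conjTranspose) i i).re *
        (-Real.log (q i)) := by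
  -- The weights |W i j|² are doubly stochastic: column sums recover the entropy of d, and row sums
  -- give the total mass of q.
  have h1 : ∑ i, ∑ j, Complex.normSq (W i j) * Real.negMulLog (d j) ≤
      ∑ i, ∑ j, Complex.normSq (W i j) * (d j * (-Real.log (q i)) + (q i - d j)) :=
    Finset.sum_le_sum fun i _ => Finset.sum_le_sum fun j _ =>
      mul_le_mul_of_nonneg_left (negMulLog_le (hd j) (hq i)) (Complex.normSq_nonneg _)
  have h2 : ∑ i, ∑ j, Complex.normSq (W i j) * Real.negMulLog (d j) =
      ∑ j, Real.negMulLog (d j) := by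
    rw [Finset.sum_comm]
    simp [← Finset.sum_mul, sum_normSq_col hW]
  have h3 : ∑ i, ∑ j, Complex.normSq (W i j) * d j = 1 := by
    rw [Finset.sum_comm]
    simp [← Finset.sum_mul, sum_normSq_col hW, hd1]
  have h4 : ∑ i, ∑ j, Complex.normSq (W i j) * q i = 1 := by
    simp [← Finset.sum_mul, sum_normSq_row hW, hq1]
  have h5 : ∑ i, ∑ j, Complex.normSq (W i j) * (d j * (-Real.log (q i)) + (q i - d j)) =
      ∑ i, (∑ j, Complex.normSq (W i j) * d j) * (-Real.log (q i)) := by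
    have : ∀ i j, Complex.normSq (W i j) * (d j * (-Real.log (q i)) + (q i - d j)) =
        Complex.normSq (W i j) * d j * (-Real.log (q i)) + (Complex.normSq (W i j) * q i -
          Complex.normSq (W i j) * d j) := fun i j => by ring
    simp only [this, Finset.sum_add_distrib, Finset.sum_sub_distrib, h3, h4, Finset.sum_mul,
      sub_self, add_zero]
  rw [h2, h5] at h1
  simpa only [conj_diagonal_diag_re] using h1

end Gibbs

/-! ### Convexity of the qubit entropy in 2√det -/

section EntropyConvexity

/-- The smaller eigenvalue of a qubit state of determinant `x ^ 2 / 4`. -/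
noncomputable def minEig (x : ℝ) : ℝ := (1 - √(1 - x ^ 2)) / 2

theorem minEig_nonneg (x : ℝ) : 0 ≤ minEig x := by
  have : √(1 - x ^ 2) ≤ 1 := Real.sqrt_le_one.mpr (by nlinarith [sq_nonneg x])
  unfold minEig; linarith

theorem minEig_le_half (x : ℝ) : minEig x ≤ 2⁻¹ := by
  have := Real.sqrt_nonneg (1 - x ^ 2)
  unfold minEig; linarith

theorem minEig_mono {x y : ℝ} (hx : 0 ≤ x) (h : x ≤ y) : minEig x ≤ minEig y := by
  have : √(1 - y ^ 2) ≤ √(1 - x ^ 2) := Real.sqrt_le_sqrt (by nlinarith)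
  unfold minEig; linarith

theorem continuous_minEig : Continuous minEig := by
  unfold minEig; fun_prop

/-- The left side is the first term of the power series, whose terms are all nonnegative. It gives
the sign of the second derivative in `convexOn_binEntropy_minEig`. -/
theorem two_mul_le_log_sub_log {s : ℝ} (h0 : 0 ≤ s) (h1 : s < 1) :
    2 * s ≤ Real.log (1 + s) - Real.log (1 - s) := by
  have h := Real.hasSum_log_sub_log_of_abs_lt_one (abs_lt.mpr ⟨by linarith, h1⟩)
  have := sum_le_hasSum {0} (fun k _ => by positivity) h
  simpa using this

theorem hasDerivAt_sqrt_one_sub_sq {x : ℝ} (hx : x ∈ Set.Ioo (0 : ℝ) 1) :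
    HasDerivAt (fun x : ℝ => √(1 - x ^ 2)) (-(x / √(1 - x ^ 2))) x := by
  have h1 : 0 < 1 - x ^ 2 := by nlinarith [hx.1, hx.2]
  have h := (((hasDerivAt_id x).pow 2).const_sub 1).sqrt h1.ne'
  refine h.congr_deriv ?_
  have : √(1 - x ^ 2) ≠ 0 := (Real.sqrt_pos.mpr h1).ne'
  simp only [id, Pi.pow_apply]
  field_simp
  norm_num

theorem sqrt_one_sub_sq_mem {x : ℝ} (hx : x ∈ Set.Ioo (0 : ℝ) 1) :
    √(1 - x ^ 2) ∈ Set.Ioo (0 : ℝ) 1 :=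
  ⟨Real.sqrt_pos.mpr (by nlinarith [hx.1, hx.2]),
    (Real.sqrt_lt' one_pos).mpr (by nlinarith [hx.1, hx.2])⟩

theorem hasDerivAt_minEig {x : ℝ} (hx : x ∈ Set.Ioo (0 : ℝ) 1) :
    HasDerivAt minEig (x / √(1 - x ^ 2) / 2) x := by
  refine (((hasDerivAt_sqrt_one_sub_sq hx).const_sub 1).div_const 2).congr_deriv ?_
  simp

theorem hasDerivAt_div_sqrt {x : ℝ} (hx : x ∈ Set.Ioo (0 : ℝ) 1) :
    HasDerivAt (fun x : ℝ => x / √(1 - x ^ 2)) (1 / √(1 - x ^ 2) ^ 3) x := by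
  have hs := sqrt_one_sub_sq_mem hx
  have hsq : √(1 - x ^ 2) ^ 2 = 1 - x ^ 2 := Real.sq_sqrt (by nlinarith [hx.1, hx.2])
  refine ((hasDerivAt_id x).div (hasDerivAt_sqrt_one_sub_sq hx) hs.1.ne').congr_deriv ?_
  have := hs.1.ne'
  simp only [id]
  field_simp
  rw [hsq]; ring

theorem convexOn_minEig : ConvexOn ℝ (Set.Icc 0 1) minEig := by
  refine convexOn_of_hasDerivWithinAt2_nonneg (convex_Icc 0 1) continuous_minEig.continuousOn
    (f' := fun x => x / √(1 - x ^ 2) / 2) (f'' := fun x => 1 / √(1 - x ^ 2) ^ 3 / 2) ?_ ?_ ?_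
  all_goals rw [interior_Icc]
  · exact fun x hx => (hasDerivAt_minEig hx).hasDerivWithinAt
  · exact fun x hx => ((hasDerivAt_div_sqrt hx).div_const 2).hasDerivWithinAt
  · intro x _; positivity

/-- The entropy of a qubit state is a convex function of `x = 2 √det`. -/
theorem convexOn_binEntropy_minEig :
    ConvexOn ℝ (Set.Icc 0 1) fun x => Real.binEntropy (minEig x) := by
  refine convexOn_of_hasDerivWithinAt2_nonneg (convex_Icc 0 1)
    (Real.binEntropy_continuous.comp continuous_minEig).continuousOn
    -- With s = √(1 - x²) and L = log((1 + s)/(1 - s)), the derivatives are xL/(2s) and (L -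
    -- 2s)/(2s³).
    (f' := fun x => x / √(1 - x ^ 2) / 2 *
      (Real.log (1 + √(1 - x ^ 2)) - Real.log (1 - √(1 - x ^ 2))))
    (f'' := fun x => (Real.log (1 + √(1 - x ^ 2)) - Real.log (1 - √(1 - x ^ 2)) -
      2 * √(1 - x ^ 2)) / √(1 - x ^ 2) ^ 3 / 2) ?_ ?_ ?_
  all_goals rw [interior_Icc]
  · intro x hx
    have hs := sqrt_one_sub_sq_mem hx
    have h0 : minEig x ≠ 0 := by unfold minEig; linarith [hs.2]
    have h1 : minEig x ≠ 1 := by unfold minEig; linarith [hs.1]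
    refine HasDerivAt.hasDerivWithinAt
      (((Real.hasDerivAt_binEntropy h0 h1).comp x (hasDerivAt_minEig hx)).congr_deriv ?_)
    have e1 : 1 - minEig x = (1 + √(1 - x ^ 2)) / 2 := by unfold minEig; ring
    rw [e1, minEig, Real.log_div (by linarith [hs.1]) two_ne_zero,
      Real.log_div (by linarith [hs.2]) two_ne_zero]
    ring
  · intro x hx
    have hs := sqrt_one_sub_sq_mem hx
    have hsq : √(1 - x ^ 2) ^ 2 = 1 - x ^ 2 := Real.sq_sqrt (by nlinarith [hx.1, hx.2])
    have hd := hasDerivAt_sqrt_one_sub_sq hx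
    refine HasDerivAt.hasDerivWithinAt ((((hasDerivAt_div_sqrt hx).div_const 2).mul
      (((hd.const_add 1).log (by linarith [hs.1])).sub
        ((hd.const_sub 1).log (by linarith [hs.2])))).congr_deriv ?_)
    set s := √(1 - x ^ 2)
    have e : -(x / s) / (1 + s) - -(-(x / s)) / (1 - s) = -2 / (x * s) := by
      have := hs.1.ne'
      have := hx.1.ne'
      have : 1 + s ≠ 0 := by linarith [hs.1]
      have : 1 - s ≠ 0 := by linarith [hs.2]
      have : x ^ 2 = (1 + s) * (1 - s) := by linarith
      field_simp
      rw [this]; ring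
    rw [e]
    have := hs.1.ne'
    have := hx.1.ne'
    simp only [Pi.sub_apply]
    field_simp
    ring
  · intro x hx
    have hs := sqrt_one_sub_sq_mem hx
    have := two_mul_le_log_sub_log hs.1.le hs.2
    have h3 : 0 < √(1 - x ^ 2) ^ 3 := pow_pos hs.1 3
    exact div_nonneg (div_nonneg (by linarith) h3.le) two_pos.le

theorem binEntropy_minEig_mono {x y : ℝ} (hx : 0 ≤ x) (h : x ≤ y) :
    Real.binEntropy (minEig x) ≤ Real.binEntropy (minEig y) :=
  Real.binEntropy_strictMonoOn.monotoneOn ⟨minEig_nonneg x, minEig_le_half x⟩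
    ⟨minEig_nonneg y, minEig_le_half y⟩ (minEig_mono hx h)

end EntropyConvexity

/-! ### Qubit spectra and the entropic bound on the final energy -/

section Qubit

theorem qubitHamiltonian_eq_diagonal :
    qubitHamiltonian = Matrix.diagonal fun a => ((![0, 1] a : ℝ) : ℂ) := by
  ext i j
  fin_cases i <;> fin_cases j <;> simp [qubitHamiltonian]

theorem energy_qubitHamiltonian (ρ : Matrix (Fin 2) (Fin 2) ℂ) :
    energy ρ qubitHamiltonian = (ρ 1 1).re := by
  rw [qubitHamiltonian_eq_diagonal, energy_diagonal]
  simp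

/-- Hermitian qubit matrices of trace one and determinant `x ^ 2 / 4` with `x ∈ [0, 1]`. -/
structure IsQubitState (τ : Matrix (Fin 2) (Fin 2) ℂ) (x : ℝ) : Prop where
  isHermitian : τ.IsHermitian
  trace_eq : τ.trace = 1
  det_eq : τ.det = ((x ^ 2 / 4 : ℝ) : ℂ)
  nonneg : 0 ≤ x

theorem IsQubitState.conj {τ : Matrix (Fin 2) (Fin 2) ℂ} {x : ℝ} (h : IsQubitState τ x)
    {U : Matrix (Fin 2) (Fin 2) ℂ} (hU : U ∈ Matrix.unitaryGroup (Fin 2) ℂ) :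
    IsQubitState (U * τ * U.conjTranspose) x := by
  have hU' : U.conjTranspose * U = 1 := Matrix.mem_unitaryGroup_iff'.mp hU
  refine ⟨Matrix.isHermitian_mul_mul_conjTranspose U h.isHermitian, ?_, ?_, h.nonneg⟩
  · rw [Matrix.trace_mul_comm, ← mul_assoc, hU', one_mul, h.trace_eq]
  · rw [Matrix.det_mul_comm, ← mul_assoc, hU', one_mul, h.det_eq]

theorem eq_minEig_of_le {a b x : ℝ} (hab : a + b = 1) (hdet : a * b = x ^ 2 / 4) (h : b ≤ a) :
    b = minEig x := by
  have : 1 - x ^ 2 = (a - b) ^ 2 := by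
    have : (a + b) ^ 2 = 1 := by rw [hab]; norm_num
    linarith
  rw [minEig, this, Real.sqrt_sq (by linarith)]
  linarith

/-- Dropping |τ₁₀|² ≥ 0 from the determinant leaves (1 - 2τ₁₁)² ≤ 1 - x². -/
theorem IsQubitState.minEig_le {τ : Matrix (Fin 2) (Fin 2) ℂ} {x : ℝ} (h : IsQubitState τ x) :
    minEig x ≤ (τ 1 1).re := by
  have ht := congrArg Complex.re h.trace_eq
  have hd := (congrArg Complex.re h.det_eq).trans (Complex.ofReal_re _)
  have h0 : (τ 0 0).im = 0 := Complex.conj_eq_iff_im.mp (h.isHermitian.apply 0 0)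
  have h1 : τ 0 1 = (starRingEnd ℂ) (τ 1 0) := (h.isHermitian.apply 0 1).symm
  rw [Matrix.trace_fin_two] at ht
  rw [Matrix.det_fin_two, h1] at hd
  simp [h0] at ht hd
  have h2 : (1 - 2 * (τ 1 1).re) ^ 2 ≤ 1 - x ^ 2 := by
    have : (τ 0 0).re = 1 - (τ 1 1).re := by linarith
    rw [this] at hd
    nlinarith [mul_self_nonneg (τ 1 0).re, mul_self_nonneg (τ 1 0).im]
  have := Real.le_sqrt_of_sq_le h2
  unfold minEig; linarith

theorem IsQubitState.exists_diagonalization {τ : Matrix (Fin 2) (Fin 2) ℂ} {x : ℝ}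
    (h : IsQubitState τ x) : ∃ V ∈ Matrix.unitaryGroup (Fin 2) ℂ,
      τ = V * Matrix.diagonal (fun a => ((![1 - minEig x, minEig x] a : ℝ) : ℂ)) *
        V.conjTranspose := by
  have hs := h.isHermitian.spectral_theorem
  have ht := h.isHermitian.trace_eq_sum_eigenvalues
  have hd := h.isHermitian.det_eq_prod_eigenvalues
  rw [Unitary.conjStarAlgAut_apply] at hs
  rw [h.trace_eq, Fin.sum_univ_two] at ht
  rw [h.det_eq, Fin.prod_univ_two] at hd
  have ht : h.isHermitian.eigenvalues 0 + h.isHermitian.eigenvalues 1 = 1 := by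
    simpa using (congrArg Complex.re ht).symm
  have hd : h.isHermitian.eigenvalues 0 * h.isHermitian.eigenvalues 1 = x ^ 2 / 4 := by
    have := hd.symm
    simp only [Complex.coe_algebraMap] at this
    exact_mod_cast this
  generalize h.isHermitian.eigenvalues = d at hs ht hd
  generalize h.isHermitian.eigenvectorUnitary = V at hs
  rcases le_total (d 1) (d 0) with hle | hle
  · refine ⟨V, V.2, ?_⟩
    have h1 := eq_minEig_of_le ht hd hle
    have h0 : d 0 = 1 - minEig x := by linarith
    refine hs.trans ?_
    rw [← h1, show (1 : ℝ) - d 1 = d 0 by linarith]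
    congr 3
    ext a
    fin_cases a <;> simp
  · have h1 := eq_minEig_of_le (by rw [add_comm, ht]) (by rw [mul_comm, hd]) hle
    -- The eigenvalues come in the wrong order here; the swap puts the larger one on the ground
    -- level.
    let P : Matrix (Fin 2) (Fin 2) ℂ := !![0, 1; 1, 0]
    have hPc : P.conjTranspose = P := by
      ext i j
      fin_cases i <;> fin_cases j <;> simp [P]
    have hP : P ∈ Matrix.unitaryGroup (Fin 2) ℂ := by
      rw [Matrix.mem_unitaryGroup_iff, Matrix.star_eq_conjTranspose, hPc]
      ext i j
      fin_cases i <;> fin_cases j <;> simp [P]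
    refine ⟨V * P, mul_mem V.2 hP, hs.trans ?_⟩
    rw [← h1, show (1 : ℝ) - d 0 = d 1 by linarith, Matrix.conjTranspose_mul, hPc]
    have : Matrix.diagonal (RCLike.ofReal ∘ d) =
        P * Matrix.diagonal (fun a => ((![d 1, d 0] a : ℝ) : ℂ)) * P := by
      have : Matrix.diagonal (fun a => ((![d 1, d 0] a : ℝ) : ℂ)) =
          !![(d 1 : ℂ), 0; 0, (d 0 : ℂ)] := by
        ext i j
        fin_cases i <;> fin_cases j <;> simp
      rw [this]
      ext i j
      fin_cases i <;> fin_cases j <;> simp [P, Matrix.mul_apply, Fin.sum_univ_two]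
    rw [this]
    simp only [mul_assoc]
    rfl

theorem IsQubitState.exists_energy_eq {τ : Matrix (Fin 2) (Fin 2) ℂ} {x : ℝ}
    (h : IsQubitState τ x) : ∃ U ∈ Matrix.unitaryGroup (Fin 2) ℂ,
      energy (U * τ * U.conjTranspose) qubitHamiltonian = minEig x := by
  obtain ⟨V, hV, e⟩ := h.exists_diagonalization
  refine ⟨V.conjTranspose, Unitary.star_mem hV, ?_⟩
  have hV' : V.conjTranspose * V = 1 := Matrix.mem_unitaryGroup_iff'.mp hV
  rw [energy_qubitHamiltonian, e, Matrix.conjTranspose_conjTranspose]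
  simp only [← mul_assoc]
  rw [hV', one_mul, mul_assoc, hV', mul_one]
  simp

theorem IsQubitState.ergotropy_eq {τ : Matrix (Fin 2) (Fin 2) ℂ} {x : ℝ}
    (h : IsQubitState τ x) :
    ergotropy τ qubitHamiltonian = energy τ qubitHamiltonian - minEig x := by
  obtain ⟨U, hU, e⟩ := h.exists_energy_eq
  refine IsGreatest.csSup_eq ⟨⟨U, hU, by rw [e]⟩, ?_⟩
  rintro _ ⟨U, hU, rfl⟩
  rw [energy_qubitHamiltonian (U * τ * _)]
  linarith [(h.conj hU).minEig_le]

theorem totalHamiltonian_qubit_nonneg {n : ℕ} (i : Fin n → Fin 2) :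
    0 ≤ ∑ t, (![0, 1] (i t) : ℝ) :=
  Finset.sum_nonneg fun t _ => by generalize i t = a; fin_cases a <;> simp

theorem minEig_weights_nonneg (x : ℝ) (a : Fin 2) :
    0 ≤ (![1 - minEig x, minEig x] : Fin 2 → ℝ) a := by
  have := minEig_nonneg x
  have := minEig_le_half x
  fin_cases a <;> simp <;> linarith

/-- Diagonalising each factor puts every state on the global unitary orbit in the form required by
`gibbs_inequality`, with a product spectrum. -/
theorem exists_conj_tensor_eq {n : ℕ} {τ : Fin n → Matrix (Fin 2) (Fin 2) ℂ} {x : Fin n → ℝ}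
    (h : ∀ t, IsQubitState (τ t) (x t)) {U : Matrix (Fin n → Fin 2) (Fin n → Fin 2) ℂ}
    (hU : U ∈ Matrix.unitaryGroup _ ℂ) :
    ∃ W ∈ Matrix.unitaryGroup (Fin n → Fin 2) ℂ, U * tensor τ * U.conjTranspose =
      W * Matrix.diagonal (fun i =>
        ((∏ t, (![1 - minEig (x t), minEig (x t)] : Fin 2 → ℝ) (i t) : ℝ) : ℂ)) *
      W.conjTranspose := by
  choose V hV e using fun t => (h t).exists_diagonalization
  refine ⟨U * tensor V, mul_mem hU (tensor_mem_unitaryGroup hV), ?_⟩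
  simp only [Complex.ofReal_prod]
  rw [← tensor_diagonal fun t a => (((![1 - minEig (x t), minEig (x t)] : Fin 2 → ℝ) a : ℝ) : ℂ),
    Matrix.conjTranspose_mul, tensor_conjTranspose, funext e, ← tensor_mul, ← tensor_mul]
  simp only [mul_assoc]

/-- The entropy of a product of qubit states bounds the energy extractable by unitaries: no unitary
brings the energy below that of a thermal product state of no larger entropy. -/
theorem mul_le_energy_conj_tensor_of_lt {n : ℕ} {τ : Fin n → Matrix (Fin 2) (Fin 2) ℂ}
    {x : Fin n → ℝ} (h : ∀ t, IsQubitState (τ t) (x t)) {μ : ℝ} (h0 : 0 < μ) (h1 : μ < 2⁻¹)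
    (hS : n * Real.binEntropy μ ≤ ∑ t, Real.binEntropy (minEig (x t)))
    {U : Matrix (Fin n → Fin 2) (Fin n → Fin 2) ℂ} (hU : U ∈ Matrix.unitaryGroup _ ℂ) :
    n * μ ≤ energy (U * tensor τ * U.conjTranspose) (totalHamiltonian qubitHamiltonian n) := by
  obtain ⟨W, hW, hτ⟩ := exists_conj_tensor_eq h hU
  let p : Fin n → Fin 2 → ℝ := fun t => ![1 - minEig (x t), minEig (x t)]
  have hp0 : ∀ t a, 0 ≤ p t a := fun t a => minEig_weights_nonneg (x t) a
  have hp1 : ∀ t, ∑ a, p t a = 1 := fun t => by simp [p]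
  let q : (Fin n → Fin 2) → ℝ := fun i => ∏ t, ![1 - μ, μ] (i t)
  have hq0 : ∀ a, 0 < (![1 - μ, μ] : Fin 2 → ℝ) a := by
    intro a; fin_cases a <;> simp <;> linarith
  -- Since q is a thermal product distribution, -log q is affine in the energy, with inverse
  -- temperature log(1 - μ) - log μ as slope. The cross entropy in Gibbs' inequality is therefore
  -- affine in the mean energy.
  have hlog : ∀ i, -Real.log (q i) = n * (-Real.log (1 - μ)) +
      (Real.log (1 - μ) - Real.log μ) * ∑ t, (![0, 1] (i t) : ℝ) := by
    intro i
    have h2 : ∀ a : Fin 2, Real.log ((![1 - μ, μ] : Fin 2 → ℝ) a) =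
        Real.log (1 - μ) - (Real.log (1 - μ) - Real.log μ) * (![0, 1] : Fin 2 → ℝ) a := by
      intro a; fin_cases a <;> simp
    simp only [q]
    rw [Real.log_prod fun t _ => (hq0 (i t)).ne', Finset.sum_congr rfl fun t _ => h2 (i t),
      Finset.sum_sub_distrib, ← Finset.mul_sum]
    simp
    ring
  have hG := gibbs_inequality hW (fun i => Finset.prod_nonneg fun t _ => hp0 t (i t))
    (sum_prod_eq_one p hp1) (fun i => Finset.prod_pos fun t _ => hq0 (i t))
    (sum_prod_eq_one (fun _ : Fin n => (![1 - μ, μ] : Fin 2 → ℝ)) fun _ => by simp)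
  rw [sum_negMulLog_prod p hp1, ← hτ] at hG
  have hL : ∑ t, ∑ a, Real.negMulLog (p t a) = ∑ t, Real.binEntropy (minEig (x t)) := by
    refine Finset.sum_congr rfl fun t _ => ?_
    simp [p, Real.binEntropy_eq_negMulLog_add_negMulLog_one_sub, add_comm]
  have htr : ∑ i, ((U * tensor τ * U.conjTranspose) i i).re = 1 := by
    rw [hτ]
    simp only [conj_diagonal_diag_re]
    rw [Finset.sum_comm]
    simp only [← Finset.sum_mul, sum_normSq_col hW, one_mul]
    exact sum_prod_eq_one p hp1
  have hR : ∑ i, ((U * tensor τ * U.conjTranspose) i i).re * (-Real.log (q i)) =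
      n * (-Real.log (1 - μ)) + (Real.log (1 - μ) - Real.log μ) *
        energy (U * tensor τ * U.conjTranspose) (totalHamiltonian qubitHamiltonian n) := by
    rw [qubitHamiltonian_eq_diagonal, energy_totalHamiltonian]
    simp only [hlog, mul_add, Finset.sum_add_distrib, ← Finset.sum_mul, htr, one_mul,
      Finset.mul_sum]
    congr 1
    refine Finset.sum_congr rfl fun i _ => Finset.sum_congr rfl fun t _ => by ring
  rw [hL] at hG
  have hG' := hS.trans (hG.trans_eq hR)
  have hB : Real.binEntropy μ = -Real.log (1 - μ) + μ * (Real.log (1 - μ) - Real.log μ) := by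
    rw [Real.binEntropy_eq_negMulLog_add_negMulLog_one_sub, Real.negMulLog, Real.negMulLog]
    ring
  rw [hB] at hG'
  -- Positive temperature, from μ < 1/2, allows division by the slope.
  have hpos : 0 < Real.log (1 - μ) - Real.log μ :=
    sub_pos.mpr (Real.log_lt_log h0 (by linarith))
  refine le_of_mul_le_mul_left ?_ hpos
  linarith

theorem energy_conj_tensor_nonneg {n : ℕ} {τ : Fin n → Matrix (Fin 2) (Fin 2) ℂ}
    {x : Fin n → ℝ} (h : ∀ t, IsQubitState (τ t) (x t))
    {U : Matrix (Fin n → Fin 2) (Fin n → Fin 2) ℂ} (hU : U ∈ Matrix.unitaryGroup _ ℂ) :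
    0 ≤ energy (U * tensor τ * U.conjTranspose) (totalHamiltonian qubitHamiltonian n) := by
  obtain ⟨W, -, e⟩ := exists_conj_tensor_eq h hU
  rw [qubitHamiltonian_eq_diagonal, energy_totalHamiltonian, e]
  refine Finset.sum_nonneg fun i _ => mul_nonneg ?_ (totalHamiltonian_qubit_nonneg i)
  rw [conj_diagonal_diag_re]
  exact Finset.sum_nonneg fun j _ => mul_nonneg (Complex.normSq_nonneg _)
    (Finset.prod_nonneg fun t _ => minEig_weights_nonneg _ _)

/-- The thermal comparison needs 0 < μ < 1/2. The value 0 is covered by positivity of the energy;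
positive values, including 1/2, are limits of smaller μ. -/
theorem mul_minEig_le_energy_conj_tensor {n : ℕ} {τ : Fin n → Matrix (Fin 2) (Fin 2) ℂ}
    {x : Fin n → ℝ} (h : ∀ t, IsQubitState (τ t) (x t)) {y : ℝ}
    (hS : n * Real.binEntropy (minEig y) ≤ ∑ t, Real.binEntropy (minEig (x t)))
    {U : Matrix (Fin n → Fin 2) (Fin n → Fin 2) ℂ} (hU : U ∈ Matrix.unitaryGroup _ ℂ) :
    n * minEig y ≤ energy (U * tensor τ * U.conjTranspose)
      (totalHamiltonian qubitHamiltonian n) := by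
  have hE := energy_conj_tensor_nonneg h hU
  rcases (minEig_nonneg y).eq_or_lt with h0 | h0
  · rwa [← h0, mul_zero]
  have hlim : Tendsto (fun μ : ℝ => n * μ) (𝓝[<] minEig y) (𝓝 (n * minEig y)) :=
    ((continuous_const.mul continuous_id).tendsto _).mono_left nhdsWithin_le_nhds
  refine le_of_tendsto hlim ?_
  filter_upwards [Ioo_mem_nhdsLT h0] with μ hμ
  have hy := minEig_le_half y
  refine mul_le_energy_conj_tensor_of_lt h hμ.1 (hμ.2.trans_le hy) (le_trans ?_ hS) hU
  exact mul_le_mul_of_nonneg_left (Real.binEntropy_strictMonoOn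
    ⟨hμ.1.le, hμ.2.le.trans hy⟩ ⟨h0.le, hy⟩ hμ.2).le n.cast_nonneg

end Qubit

/-! ### One use of the channel -/

section Channel

theorem IsDensity.energy_mem {ρ : Matrix (Fin 2) (Fin 2) ℂ} (h : IsDensity ρ) :
    energy ρ qubitHamiltonian ∈ Set.Icc (0 : ℝ) 1 := by
  rw [energy_qubitHamiltonian]
  have ht := congrArg Complex.re h.2
  rw [Matrix.trace_fin_two] at ht
  simp at ht
  have h0 := (Complex.le_def.mp (h.1.diag_nonneg (i := 0))).1
  have h1 := (Complex.le_def.mp (h.1.diag_nonneg (i := 1))).1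
  simp at h0 h1
  exact ⟨h1, by linarith⟩

/-- Twice the square root of the least output determinant of `gadc γ η` at input energy `ε`. -/
noncomputable def gadcConcurrence (γ η ε : ℝ) : ℝ :=
  2 * √((1 - γ) * γ * (ε - η) ^ 2 + γ * η * (1 - η))

/-- The optimal output ergotropy of one use of `gadc γ η` at input energy exactly `ε`. -/
noncomputable def gadcErgotropy (γ η ε : ℝ) : ℝ :=
  γ * η + (1 - γ) * ε - minEig (gadcConcurrence γ η ε)

variable {γ η : ℝ}

theorem gadc_isHermitian (γ η : ℝ) (ρ : Matrix (Fin 2) (Fin 2) ℂ) (hρ : ρ.IsHermitian)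
    (ht : ρ.trace = 1) : (gadc γ η ρ).IsHermitian := by
  rw [gadc_of_trace_eq_one γ η ρ ht]
  have h11 : (starRingEnd ℂ) (ρ 1 1) = ρ 1 1 := hρ.apply 1 1
  have h01 : (starRingEnd ℂ) (ρ 1 0) = ρ 0 1 := hρ.apply 0 1
  have h10 : (starRingEnd ℂ) (ρ 0 1) = ρ 1 0 := hρ.apply 1 0
  ext i j
  fin_cases i <;> fin_cases j <;> simp [Matrix.conjTranspose_apply, h11, h01, h10]

theorem gadc_trace (γ η : ℝ) (ρ : Matrix (Fin 2) (Fin 2) ℂ) : (gadc γ η ρ).trace = ρ.trace := by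
  simp [gadc, Matrix.trace_fin_two]
  ring

/-- Eliminating |ρ₀₁|² in favour of det ρ separates the dependence on the energy from a nonnegative
term that vanishes on pure states. Pure inputs thus minimise the output determinant at given energy.
-/
theorem gadc_det (hγ : γ ∈ Set.Icc (0 : ℝ) 1) (η : ℝ) {ρ : Matrix (Fin 2) (Fin 2) ℂ}
    (h : IsDensity ρ) : (gadc γ η ρ).det =
      (((1 - γ) * γ * (energy ρ qubitHamiltonian - η) ^ 2 + γ * η * (1 - η) +
        (1 - γ) * ρ.det.re : ℝ) : ℂ) := by
  have h11 : ρ 1 1 = ((ρ 1 1).re : ℂ) :=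
    (Complex.conj_eq_iff_re.mp (h.1.isHermitian.apply 1 1)).symm
  have hdet : (ρ.det.re : ℂ) = ρ.det :=
    Complex.ext rfl (Complex.le_def.mp h.1.det_nonneg).2
  have h00 : ρ 0 0 = 1 - ρ 1 1 := by
    rw [← h.2, Matrix.trace_fin_two]; ring
  have hs : ((√(1 - γ) : ℝ) : ℂ) ^ 2 = 1 - (γ : ℂ) := by
    rw [← Complex.ofReal_pow, Real.sq_sqrt (by linarith [hγ.2])]; push_cast; rfl
  rw [gadc_of_trace_eq_one γ η ρ h.2, energy_qubitHamiltonian]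
  push_cast
  rw [hdet, ← h11, Matrix.det_fin_two, Matrix.det_fin_two, h00]
  simp
  linear_combination (-(ρ 0 1 * ρ 1 0)) * hs

theorem gadc_energy (γ η : ℝ) {ρ : Matrix (Fin 2) (Fin 2) ℂ} (h : IsDensity ρ) :
    energy (gadc γ η ρ) qubitHamiltonian = γ * η + (1 - γ) * energy ρ qubitHamiltonian := by
  rw [gadc_of_trace_eq_one γ η ρ h.2, energy_qubitHamiltonian, energy_qubitHamiltonian]
  simp

theorem gadc_sq_nonneg (hγ : γ ∈ Set.Icc (0 : ℝ) 1) (hη : η ∈ Set.Icc (0 : ℝ) 1) (ε : ℝ) :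
    0 ≤ (1 - γ) * γ * (ε - η) ^ 2 + γ * η * (1 - η) := by
  have := hγ.1
  have := sub_nonneg.mpr hγ.2
  have := hη.1
  have := sub_nonneg.mpr hη.2
  positivity

theorem gadcConcurrence_nonneg (γ η ε : ℝ) : 0 ≤ gadcConcurrence γ η ε := by
  unfold gadcConcurrence; positivity

theorem exists_isQubitState_gadc (hγ : γ ∈ Set.Icc (0 : ℝ) 1) (hη : η ∈ Set.Icc (0 : ℝ) 1)
    {ρ : Matrix (Fin 2) (Fin 2) ℂ} (h : IsDensity ρ) :
    ∃ x, gadcConcurrence γ η (energy ρ qubitHamiltonian) ≤ x ∧ IsQubitState (gadc γ η ρ) x := by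
  have h0 := gadc_sq_nonneg hγ hη (energy ρ qubitHamiltonian)
  have h1 : 0 ≤ (1 - γ) * ρ.det.re :=
    mul_nonneg (sub_nonneg.mpr hγ.2) (Complex.le_def.mp h.1.det_nonneg).1
  refine ⟨2 * √((1 - γ) * γ * (energy ρ qubitHamiltonian - η) ^ 2 + γ * η * (1 - η) +
    (1 - γ) * ρ.det.re), ?_, gadc_isHermitian γ η ρ h.1.isHermitian h.2,
    by rw [gadc_trace, h.2], ?_, by positivity⟩
  · unfold gadcConcurrence
    exact mul_le_mul_of_nonneg_left (Real.sqrt_le_sqrt (by linarith)) two_pos.le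
  · rw [gadc_det hγ η h, mul_pow, Real.sq_sqrt (by linarith)]
    congr 1
    ring

/-- The pure qubit state of energy `ε` with real coherence. -/
noncomputable def pureState (ε : ℝ) : Matrix (Fin 2) (Fin 2) ℂ :=
  Matrix.vecMulVec ![(√(1 - ε) : ℂ), (√ε : ℂ)] (star ![(√(1 - ε) : ℂ), (√ε : ℂ)])

theorem isDensity_pureState {ε : ℝ} (hε : ε ∈ Set.Icc (0 : ℝ) 1) : IsDensity (pureState ε) := by
  refine ⟨Matrix.posSemidef_vecMulVec_self_star _, ?_⟩
  rw [Matrix.trace_fin_two, pureState, Matrix.vecMulVec_apply, Matrix.vecMulVec_apply]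
  simp [← Complex.ofReal_mul, Real.mul_self_sqrt hε.1, Real.mul_self_sqrt (sub_nonneg.mpr hε.2)]

theorem energy_pureState {ε : ℝ} (hε : 0 ≤ ε) :
    energy (pureState ε) qubitHamiltonian = ε := by
  rw [energy_qubitHamiltonian, pureState, Matrix.vecMulVec_apply]
  simp [Real.mul_self_sqrt hε]

theorem isQubitState_gadc_pureState (hγ : γ ∈ Set.Icc (0 : ℝ) 1) (hη : η ∈ Set.Icc (0 : ℝ) 1)
    {ε : ℝ} (hε : ε ∈ Set.Icc (0 : ℝ) 1) :
    IsQubitState (gadc γ η (pureState ε)) (gadcConcurrence γ η ε) := by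
  have h := isDensity_pureState hε
  refine ⟨gadc_isHermitian γ η _ h.1.isHermitian h.2, by rw [gadc_trace, h.2], ?_,
    gadcConcurrence_nonneg γ η ε⟩
  have hd : (pureState ε).det = 0 := by
    rw [Matrix.det_fin_two]
    simp only [pureState, Matrix.vecMulVec_apply]
    ring
  rw [gadc_det hγ η h, hd, energy_pureState hε.1, gadcConcurrence, mul_pow,
    Real.sq_sqrt (gadc_sq_nonneg hγ hη ε)]
  congr 1
  simp
  ring

theorem IsQubitState.le_one {τ : Matrix (Fin 2) (Fin 2) ℂ} {x : ℝ} (h : IsQubitState τ x) :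
    x ≤ 1 := by
  have hs := h.isHermitian.det_eq_prod_eigenvalues
  have ht := h.isHermitian.trace_eq_sum_eigenvalues
  rw [h.trace_eq, Fin.sum_univ_two] at ht
  rw [h.det_eq, Fin.prod_univ_two] at hs
  have ht := congrArg Complex.re ht
  have hs := congrArg Complex.re hs
  rw [Complex.ofReal_re] at hs
  simp at ht hs
  have := h.nonneg
  nlinarith [sq_nonneg (h.isHermitian.eigenvalues 0 - h.isHermitian.eigenvalues 1)]

theorem gadcConcurrence_mem (hγ : γ ∈ Set.Icc (0 : ℝ) 1) (hη : η ∈ Set.Icc (0 : ℝ) 1)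
    {ε : ℝ} (hε : ε ∈ Set.Icc (0 : ℝ) 1) : gadcConcurrence γ η ε ∈ Set.Icc (0 : ℝ) 1 :=
  ⟨gadcConcurrence_nonneg γ η ε, (isQubitState_gadc_pureState hγ hη hε).le_one⟩

/-- The function is twice the norm of an affine map into the plane, written here as ℂ. -/
theorem convexOn_gadcConcurrence (hγ : γ ∈ Set.Icc (0 : ℝ) 1) (hη : η ∈ Set.Icc (0 : ℝ) 1) :
    ConvexOn ℝ (Set.Icc 0 1) (gadcConcurrence γ η) := by
  let z : ℝ → ℂ := fun ε => ⟨√((1 - γ) * γ) * (ε - η), √(γ * η * (1 - η))⟩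
  have hz : ∀ ε, gadcConcurrence γ η ε = 2 * ‖z ε‖ := by
    intro ε
    have := hγ.1
    have := sub_nonneg.mpr hγ.2
    have := hη.1
    have := sub_nonneg.mpr hη.2
    rw [gadcConcurrence, Complex.norm_def, Complex.normSq_mk, Real.mul_self_sqrt (by positivity),
      mul_mul_mul_comm, Real.mul_self_sqrt (by positivity), sq]
  refine ⟨convex_Icc 0 1, fun x _ y _ a b ha hb hab => ?_⟩
  have hl : z (a • x + b • y) = a • z x + b • z y := by
    apply Complex.ext
    · simp only [z, smul_eq_mul, Complex.add_re, Complex.smul_re]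
      linear_combination (√((1 - γ) * γ) * η) * hab
    · simp only [z, smul_eq_mul, Complex.add_im, Complex.smul_im]
      linear_combination (-√(γ * η * (1 - η))) * hab
  have := norm_add_le (a • z x) (b • z y)
  rw [norm_smul, norm_smul, Real.norm_of_nonneg ha, Real.norm_of_nonneg hb] at this
  rw [hz, hz, hz, hl, smul_eq_mul, smul_eq_mul]
  linarith

theorem convexOn_minEig_gadcConcurrence (hγ : γ ∈ Set.Icc (0 : ℝ) 1)
    (hη : η ∈ Set.Icc (0 : ℝ) 1) :
    ConvexOn ℝ (Set.Icc 0 1) fun ε => minEig (gadcConcurrence γ η ε) := by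
  refine ⟨convex_Icc 0 1, fun x hx y hy a b ha hb hab => ?_⟩
  exact (minEig_mono (gadcConcurrence_nonneg γ η _)
    ((convexOn_gadcConcurrence hγ hη).2 hx hy ha hb hab)).trans
    (convexOn_minEig.2 (gadcConcurrence_mem hγ hη hx) (gadcConcurrence_mem hγ hη hy) ha hb hab)

theorem concaveOn_gadcErgotropy (hγ : γ ∈ Set.Icc (0 : ℝ) 1) (hη : η ∈ Set.Icc (0 : ℝ) 1) :
    ConcaveOn ℝ (Set.Icc 0 1) (gadcErgotropy γ η) := by
  refine ⟨convex_Icc 0 1, fun x hx y hy a b ha hb hab => ?_⟩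
  have := (convexOn_minEig_gadcConcurrence hγ hη).2 hx hy ha hb hab
  simp only [gadcErgotropy, smul_eq_mul] at this ⊢
  linear_combination this + γ * η * hab

theorem continuous_gadcErgotropy (γ η : ℝ) : Continuous (gadcErgotropy γ η) := by
  have : Continuous (gadcConcurrence γ η) := by unfold gadcConcurrence; fun_prop
  have := continuous_minEig.comp this
  unfold gadcErgotropy
  exact (by fun_prop : Continuous fun ε : ℝ => γ * η + (1 - γ) * ε).sub this

/-- The entropy of the output of `gadc γ η` is at least a convex function of the input energy. -/
theorem mul_binEntropy_le_sum (hγ : γ ∈ Set.Icc (0 : ℝ) 1) (hη : η ∈ Set.Icc (0 : ℝ) 1) {n : ℕ}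
    (hn : 0 < n) {ε x : Fin n → ℝ} (hε : ∀ t, ε t ∈ Set.Icc (0 : ℝ) 1)
    (hx : ∀ t, gadcConcurrence γ η (ε t) ≤ x t) :
    n * Real.binEntropy (minEig (gadcConcurrence γ η ((∑ t, ε t) / n))) ≤
      ∑ t, Real.binEntropy (minEig (x t)) := by
  have hn' : (0 : ℝ) < n := Nat.cast_pos.mpr hn
  have hw : ∑ _t : Fin n, (1 / n : ℝ) = 1 := by simp [hn'.ne']
  have hw0 : ∀ t ∈ (Finset.univ : Finset (Fin n)), (0 : ℝ) ≤ 1 / n := fun _ _ => by positivity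
  -- Jensen is used twice, for c and then for the entropy as a function of x; monotonicity of the
  -- entropy links the two.
  have j1 := (convexOn_gadcConcurrence hγ hη).map_sum_le hw0 hw (fun t _ => hε t)
  have j2 := convexOn_binEntropy_minEig.map_sum_le hw0 hw
    (fun t _ => gadcConcurrence_mem hγ hη (hε t))
  have j3 := binEntropy_minEig_mono (gadcConcurrence_nonneg γ η _) j1
  have j4 : ∑ t, Real.binEntropy (minEig (gadcConcurrence γ η (ε t))) ≤
      ∑ t, Real.binEntropy (minEig (x t)) :=
    Finset.sum_le_sum fun t _ => binEntropy_minEig_mono (gadcConcurrence_nonneg γ η _) (hx t)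
  simp only [smul_eq_mul, ← Finset.mul_sum] at j2 j3
  have j5 := mul_le_mul_of_nonneg_left (j3.trans j2) hn'.le
  rw [one_div, inv_mul_eq_div] at j5
  rw [← mul_assoc, mul_inv_cancel₀ hn'.ne', one_mul] at j5
  exact j5.trans j4

end Channel

/-! ### Many uses and the capacitance -/

section Capacitance

variable {γ η : ℝ}

theorem energy_tensor_qubit {n : ℕ} (σ : Fin n → Matrix (Fin 2) (Fin 2) ℂ)
    (hσ : ∀ t, (σ t).trace = 1) :
    energy (tensor σ) (totalHamiltonian qubitHamiltonian n) =
      ∑ t, energy (σ t) qubitHamiltonian := by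
  rw [qubitHamiltonian_eq_diagonal]
  exact energy_tensor σ hσ _

theorem sum_div_mem_Icc {n : ℕ} (hn : 0 < n) {ε : Fin n → ℝ}
    (hε : ∀ t, ε t ∈ Set.Icc (0 : ℝ) 1) : (∑ t, ε t) / n ∈ Set.Icc (0 : ℝ) 1 := by
  have hn' : (0 : ℝ) < n := Nat.cast_pos.mpr hn
  refine ⟨div_nonneg (Finset.sum_nonneg fun t _ => (hε t).1) hn'.le, (div_le_one hn').mpr ?_⟩
  simpa using Finset.sum_le_sum fun t (_ : t ∈ Finset.univ) => (hε t).2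

/-- Energy balance of a separable state sent through `n` uses of `gadc γ η`. -/
theorem IsSeparable.gadc_bound (hγ : γ ∈ Set.Icc (0 : ℝ) 1) (hη : η ∈ Set.Icc (0 : ℝ) 1) {n : ℕ}
    (hn : 0 < n) {U : Matrix (Fin n → Fin 2) (Fin n → Fin 2) ℂ}
    (hU : U ∈ Matrix.unitaryGroup _ ℂ) {ρ : Matrix (Fin n → Fin 2) (Fin n → Fin 2) ℂ}
    (h : IsSeparable ρ) :
    energy ρ (totalHamiltonian qubitHamiltonian n) / n ∈ Set.Icc (0 : ℝ) 1 ∧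
      energy (tensorPow (gadc γ η) n ρ) (totalHamiltonian qubitHamiltonian n) -
        energy (U * tensorPow (gadc γ η) n ρ * U.conjTranspose)
          (totalHamiltonian qubitHamiltonian n) ≤
        n * gadcErgotropy γ η (energy ρ (totalHamiltonian qubitHamiltonian n) / n) := by
  have hn' : (0 : ℝ) < n := Nat.cast_pos.mpr hn
  -- With U fixed, the gain is linear in ρ and the bound is concave in it, so the set of states
  -- obeying the bound is convex and only product states need checking.
  refine convexHull_min (t := {ρ : Matrix (Fin n → Fin 2) (Fin n → Fin 2) ℂ |
    energy ρ (totalHamiltonian qubitHamiltonian n) / n ∈ Set.Icc (0 : ℝ) 1 ∧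
      energy (tensorPow (gadc γ η) n ρ) (totalHamiltonian qubitHamiltonian n) -
        energy (U * tensorPow (gadc γ η) n ρ * U.conjTranspose)
          (totalHamiltonian qubitHamiltonian n) ≤
        n * gadcErgotropy γ η (energy ρ (totalHamiltonian qubitHamiltonian n) / n)}) ?_ ?_ h
  · rintro _ ⟨σ, hσ, rfl⟩
    choose x hx hq using fun t => exists_isQubitState_gadc hγ hη (hσ t)
    have hε := fun t => (hσ t).energy_mem
    simp only [Set.mem_ofPred_eq]
    rw [energy_tensor_qubit σ fun t => (hσ t).2, tensorPow_tensor,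
      energy_tensor_qubit _ fun t => (hq t).trace_eq]
    refine ⟨sum_div_mem_Icc hn hε, ?_⟩
    have hb := mul_minEig_le_energy_conj_tensor hq (mul_binEntropy_le_sum hγ hη hn hε hx) hU
    have he : ∑ t, energy (gadc γ η (σ t)) qubitHamiltonian = n * (γ * η + (1 - γ) *
        ((∑ t, energy (σ t) qubitHamiltonian) / n)) := by
      rw [Finset.sum_congr rfl fun t _ => gadc_energy γ η (hσ t), Finset.sum_add_distrib,
        Finset.sum_const, Finset.card_univ, Fintype.card_fin, nsmul_eq_mul, ← Finset.mul_sum]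
      field_simp
    rw [he, gadcErgotropy, mul_sub]
    linarith
  · rintro ρ ⟨hρ, hρ'⟩ σ ⟨hσ, hσ'⟩ a b ha hb hab
    have he : energy (a • ρ + b • σ) (totalHamiltonian qubitHamiltonian n) / n =
        a • (energy ρ (totalHamiltonian qubitHamiltonian n) / n) +
          b • (energy σ (totalHamiltonian qubitHamiltonian n) / n) := by
      rw [energy_add, energy_smul, energy_smul, smul_eq_mul, smul_eq_mul]
      ring
    refine ⟨by rw [he]; exact convex_Icc (0 : ℝ) 1 hρ hσ ha hb hab, ?_⟩
    have hc := mul_le_mul_of_nonneg_left ((concaveOn_gadcErgotropy hγ hη).2 hρ hσ ha hb hab) hn'.le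
    rw [he, tensorPow_add, tensorPow_smul, tensorPow_smul, mul_add, add_mul, mul_smul_comm,
      mul_smul_comm, smul_mul_assoc, smul_mul_assoc]
    simp only [energy_add, energy_smul]
    refine le_trans ?_ hc
    have h1 := mul_le_mul_of_nonneg_left hρ' ha
    have h2 := mul_le_mul_of_nonneg_left hσ' hb
    simp only [smul_eq_mul]
    linarith

/-- Since f need not be increasing, the optimum may lie strictly below the allowed energy;
compactness supplies a maximiser, realised by a pure state. -/
theorem exists_maxErgotropyOne_eq (hγ : γ ∈ Set.Icc (0 : ℝ) 1) (hη : η ∈ Set.Icc (0 : ℝ) 1)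
    {e : ℝ} (he : e ∈ Set.Icc (0 : ℝ) 1) : ∃ ε₀ ∈ Set.Icc 0 e,
      maxErgotropyOne (gadc γ η) qubitHamiltonian e = gadcErgotropy γ η ε₀ ∧
      ∀ ε ∈ Set.Icc 0 e, gadcErgotropy γ η ε ≤ gadcErgotropy γ η ε₀ := by
  obtain ⟨ε₀, hε₀, hmax⟩ := isCompact_Icc.exists_isMaxOn (Set.nonempty_Icc.mpr he.1)
    (continuous_gadcErgotropy γ η).continuousOn
  have h01 : ε₀ ∈ Set.Icc (0 : ℝ) 1 := ⟨hε₀.1, hε₀.2.trans he.2⟩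
  refine ⟨ε₀, hε₀, IsGreatest.csSup_eq ⟨⟨pureState ε₀, isDensity_pureState h01, ?_, ?_⟩, ?_⟩,
    fun ε hε => hmax hε⟩
  · rw [energy_pureState h01.1]; exact hε₀.2
  · rw [(isQubitState_gadc_pureState hγ hη h01).ergotropy_eq,
      gadc_energy γ η (isDensity_pureState h01), energy_pureState h01.1, gadcErgotropy]
  · rintro _ ⟨ρ, hρ, hle, rfl⟩
    obtain ⟨x, hx, hq⟩ := exists_isQubitState_gadc hγ hη hρ
    refine le_trans ?_ (hmax ⟨hρ.energy_mem.1, hle⟩)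
    rw [hq.ergotropy_eq, gadc_energy γ η hρ, gadcErgotropy]
    linarith [minEig_mono (gadcConcurrence_nonneg γ η _) hx]

theorem chi_gadc (hγ : γ ∈ Set.Icc (0 : ℝ) 1) (hη : η ∈ Set.Icc (0 : ℝ) 1) {e : ℝ}
    (he : e ∈ Set.Icc (0 : ℝ) 1) :
    chi (gadc γ η) qubitHamiltonian e = maxErgotropyOne (gadc γ η) qubitHamiltonian e := by
  refine IsGreatest.csSup_eq ⟨⟨1, fun _ => 1, fun _ => e, by simp, by simp, fun _ => he, by simp,
    by simp⟩, ?_⟩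
  rintro _ ⟨k, p, ε, hp, hp1, hε, hle, rfl⟩
  choose ε' hε' hM _ using fun j => exists_maxErgotropyOne_eq hγ hη (hε j)
  obtain ⟨ε₀, -, hM₀, hmax⟩ := exists_maxErgotropyOne_eq hγ hη he
  simp only [hM, hM₀]
  have hj := (concaveOn_gadcErgotropy hγ hη).le_map_sum (fun j _ => hp j) hp1
    fun j _ => ⟨(hε' j).1, (hε' j).2.trans (hε j).2⟩
  refine hj.trans (hmax _ ⟨Finset.sum_nonneg fun j _ => mul_nonneg (hp j) (hε' j).1, ?_⟩)
  exact (Finset.sum_le_sum fun j _ => mul_le_mul_of_nonneg_left (hε' j).2 (hp j)).trans hle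

/-- Separable inputs to `n` uses of `gadc γ η` yield exactly `n` times the one-use ergotropy. -/
theorem maxErgotropySep_gadc (hγ : γ ∈ Set.Icc (0 : ℝ) 1) (hη : η ∈ Set.Icc (0 : ℝ) 1) {e : ℝ}
    (he : e ∈ Set.Icc (0 : ℝ) 1) {n : ℕ} (hn : 0 < n) :
    maxErgotropySep (gadc γ η) qubitHamiltonian n (n * e) =
      n * maxErgotropyOne (gadc γ η) qubitHamiltonian e := by
  have hn' : (0 : ℝ) < n := Nat.cast_pos.mpr hn
  obtain ⟨ε₀, hε₀, hM, hmax⟩ := exists_maxErgotropyOne_eq hγ hη he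
  rw [hM]
  -- Stated as an upper bound on the set of gains, this also supplies the boundedness needed by
  -- `le_csSup`.
  have hupper : ∀ ρ : Matrix (Fin n → Fin 2) (Fin n → Fin 2) ℂ, IsSeparable ρ →
      energy ρ (totalHamiltonian qubitHamiltonian n) ≤ n * e →
      n * gadcErgotropy γ η ε₀ ∈ upperBounds {w : ℝ | ∃ U ∈ Matrix.unitaryGroup _ ℂ,
        w = energy (tensorPow (gadc γ η) n ρ) (totalHamiltonian qubitHamiltonian n) -
          energy (U * tensorPow (gadc γ η) n ρ * U.conjTranspose)
            (totalHamiltonian qubitHamiltonian n)} := by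
    rintro ρ hρ hle _ ⟨U, hU, rfl⟩
    obtain ⟨h1, h2⟩ := hρ.gadc_bound hγ hη hn hU
    refine h2.trans (mul_le_mul_of_nonneg_left (hmax _ ⟨h1.1, ?_⟩) hn'.le)
    rwa [div_le_iff₀' hn']
  have hne : ∀ ρ : Matrix (Fin n → Fin 2) (Fin n → Fin 2) ℂ,
      {w : ℝ | ∃ U ∈ Matrix.unitaryGroup (Fin n → Fin 2) ℂ,
        w = energy ρ (totalHamiltonian qubitHamiltonian n) -
          energy (U * ρ * U.conjTranspose) (totalHamiltonian qubitHamiltonian n)}.Nonempty :=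
    fun ρ => ⟨_, 1, one_mem _, rfl⟩
  have h01 : ε₀ ∈ Set.Icc (0 : ℝ) 1 := ⟨hε₀.1, hε₀.2.trans he.2⟩
  have hd := isDensity_pureState h01
  have hq := isQubitState_gadc_pureState hγ hη h01
  have hsep : IsSeparable (tensor fun _ : Fin n => pureState ε₀) :=
    subset_convexHull ℝ _ ⟨_, fun _ => hd, rfl⟩
  have hen : energy (tensor fun _ : Fin n => pureState ε₀)
      (totalHamiltonian qubitHamiltonian n) ≤ n * e := by
    rw [energy_tensor_qubit _ fun _ => hd.2]
    simpa [energy_pureState h01.1] using mul_le_mul_of_nonneg_left hε₀.2 hn'.le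
  refine IsGreatest.csSup_eq ⟨⟨_, hsep, hen, le_antisymm ?_ ?_⟩, ?_⟩
  -- Attainment: the same optimal one-cell unitary acts on every cell of the product of pure states.
  · obtain ⟨U, hU, hUe⟩ := hq.exists_energy_eq
    refine le_csSup ⟨_, hupper _ hsep hen⟩ ⟨tensor fun _ => U,
      tensor_mem_unitaryGroup fun _ => hU, ?_⟩
    rw [tensorPow_tensor, tensor_conjTranspose, tensor_mul, tensor_mul,
      energy_tensor_qubit _ fun _ => hq.trace_eq, energy_tensor_qubit _ fun _ =>
        (hq.conj hU).trace_eq]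
    simp only [hUe, gadc_energy γ η hd, energy_pureState h01.1, gadcErgotropy]
    simp
    ring
  · exact csSup_le (hne _) (hupper _ hsep hen)
  · rintro _ ⟨ρ, hρ, hle, rfl⟩
    exact csSup_le (hne _) (hupper ρ hρ hle)

theorem tendsto_maxErgotropySep_gadc (hγ : γ ∈ Set.Icc (0 : ℝ) 1)
    (hη : η ∈ Set.Icc (0 : ℝ) 1) {e : ℝ} (he : e ∈ Set.Icc (0 : ℝ) 1) :
    Tendsto (fun n : ℕ => maxErgotropySep (gadc γ η) qubitHamiltonian n (n * e) / n) atTop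
      (𝓝 (chi (gadc γ η) qubitHamiltonian e)) := by
  refine tendsto_const_nhds.congr' ?_
  -- The sequence is constant for n > 0; at n = 0 the quotient has the default value 0.
  filter_upwards [eventually_gt_atTop 0] with n hn
  have hn' : (n : ℝ) ≠ 0 := Nat.cast_ne_zero.mpr hn.ne'
  rw [maxErgotropySep_gadc hγ hη he hn, chi_gadc hγ hη he, mul_div_cancel_left₀ _ hn']

end Capacitance

end QBattery

theorem mainTheorem5 :
    (∀ γ ∈ Set.Icc (0 : ℝ) 1, ∀ η ∈ Set.Icc (0 : ℝ) (1 / 2), ∀ e ∈ Set.Icc (0 : ℝ) 1,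
      Tendsto
          (fun n : ℕ =>
            QBattery.maxErgotropySep (QBattery.gadc γ η) QBattery.qubitHamiltonian n (n * e) / n)
          atTop
          (𝓝 (QBattery.sepCapacitance (QBattery.gadc γ η) QBattery.qubitHamiltonian e)) ∧
        QBattery.sepCapacitance (QBattery.gadc γ η) QBattery.qubitHamiltonian e =
          QBattery.chi (QBattery.gadc γ η) QBattery.qubitHamiltonian e) ∧
    (∀ γ ∈ Set.Icc (0 : ℝ) 1, ∀ e ∈ Set.Icc (0 : ℝ) 1,
      Tendsto
          (fun n : ℕ =>
            QBattery.maxErgotropySep (QBattery.adc γ) QBattery.qubitHamiltonian n (n * e) / n)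
          atTop
          (𝓝 (QBattery.sepCapacitance (QBattery.adc γ) QBattery.qubitHamiltonian e)) ∧
        QBattery.sepCapacitance (QBattery.adc γ) QBattery.qubitHamiltonian e =
          QBattery.chi (QBattery.adc γ) QBattery.qubitHamiltonian e) := by
  have key : ∀ γ ∈ Set.Icc (0 : ℝ) 1, ∀ η ∈ Set.Icc (0 : ℝ) (1 / 2), ∀ e ∈ Set.Icc (0 : ℝ) 1,
      Tendsto
          (fun n : ℕ =>
            QBattery.maxErgotropySep (QBattery.gadc γ η) QBattery.qubitHamiltonian n (n * e) / n)
          atTop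
          (𝓝 (QBattery.sepCapacitance (QBattery.gadc γ η) QBattery.qubitHamiltonian e)) ∧
        QBattery.sepCapacitance (QBattery.gadc γ η) QBattery.qubitHamiltonian e =
          QBattery.chi (QBattery.gadc γ η) QBattery.qubitHamiltonian e := by
    intro γ hγ η hη e he
    have h := QBattery.tendsto_maxErgotropySep_gadc hγ ⟨hη.1, hη.2.trans (by norm_num)⟩ he
    have h' : QBattery.sepCapacitance (QBattery.gadc γ η) QBattery.qubitHamiltonian e =
        QBattery.chi (QBattery.gadc γ η) QBattery.qubitHamiltonian e := h.limUnder_eq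
    exact ⟨h' ▸ h, h'⟩
  refine ⟨key, fun γ hγ e he => ?_⟩
  have h := key γ hγ 0 ⟨le_rfl, by norm_num⟩ e he
  rwa [QBattery.gadc_zero] at h
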